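/- Let $E$ be a real or complex normed vector space with a normalised (algebraic) basis $(e_i)_{i\in\mathbb N}$. For $x=\sum_i a_ie_i\in E$ (a finite sum) let $\operatorname{supp}(x)=\{i: a_i\neq 0\}$; write $k<x$, $x<n$, $x<y$ for $k<\min\operatorname{supp}(x)$, $\max\operatorname{supp}(x)<n$, $\max\operatorname{supp}(x)<\min\operatorname{supp}(y)$. Let $bb(e_i)\subseteq E^{\mathbb N}$ be the set of infinite normalised block sequences, i.e. sequences of norm-one vectors with $x_0<x_1<x_2<\cdots$. Here $E$ carries the standard Borel structure of the increasing union of its finite-dimensional subspaces $[e_0,\dots,e_n]$ (this is the Borel structure of the norm), and $\mathcal B\subseteq bb(e_i)$ is coanalytic if $bb(e_i)\setminus\mathcal B$ is an analytic subset of $E^{\mathbb N}$. Write $\Delta>0$ if $\Delta=(\delta_i)_{i\ge 0}$ is a decreasing sequence of strictly positive reals converging to $0$, and put $$\operatorname{Int}_\Delta(\mathcal B)=\{(y_i)\in bb(e_i) : \forall (x_i)\in bb(e_i)\ \big(\forall i\ \|x_i-y_i\|<\delta_i\ \Rightarrow\ (x_i)\in\mathcal B\big)\}.$$ For a strictly increasing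 sequence $(m_i)$ of natural numbers and $(x_i)\in bb(e_i)$, let $R(m_i,x_i)$ mean that for every $i$ there is $j$ with $m_0<x_i<m_j<m_{j+1}<x_{i+1}$. In the infinite asymptotic game (IAG), players I and II alternate, I beginning: I plays natural numbers $n_0,n_1,\dots$, and II plays normalised vectors $x_0<x_1<\cdots$ of $E$ with $n_i<x_i$; the outcome is $(x_i)$. A player has a strategy to play in $\mathcal A$ if he has a strategy forcing the outcome to lie in $\mathcal A$. A block tree is a non-empty set $T$ of finite normalised block sequences, closed under initial segments, such that for every $s\in T$ (including $s=\emptyset$) the set of $y$ with $s^\frown y\in T$ is $\{y_j\}_{j\in\mathbb N}$ for some $(y_j)\in bb(e_i)$ which, if $s\ne\emptyset$, satisfies $x<y_0$ for the last vector $x$ of $s$. Let $[T]$ be the set of $(x_i)\in bb(e_i)$ all of whose finite initial segments lie in $T$. **Theorem.** Let $\mathcal B\subseteq bb(e_i)$ be coanalytic. Then the following are equivalent: (d) there are $\Delta>0$ and a strictly increasing sequence $(m_i)$ of natural numbers such that every $(x_i)\in bb(e_i)$ with $R(m_i,x_i)$ lies in $\operatorname{Int}_\Delta(\mathcal B)$;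 (e) there is $\Delta>0$ such that I has a strategy in (IAG) to play in $\operatorname{Int}_\Delta(\mathcal B)$; (f) there is $\Delta>0$ such that $[T]\cap\operatorname{Int}_\Delta(\mathcal B)\neq\emptyset$ for every block tree $T$. Moreover, these perturbed games are determined in the following sense: exactly one of the following holds: (e), or, for every $\Delta>0$, II has a strategy in (IAG) to play in $bb(e_i)\setminus\operatorname{Int}_\Delta(\mathcal B)$. -/

import Mathlib

open Set Filter Topology MeasureTheory

namespace AsymptoticGame

variable {𝕜 E : Type*} [RCLike 𝕜] [NormedAddCommGroup E] [NormedSpace 𝕜 E]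

/-- The support of `x = ∑ aᵢ eᵢ` : the finite set of all `i` with `aᵢ ≠ 0`. -/
noncomputable def supp (e : Module.Basis ℕ 𝕜 E) (x : E) : Finset ℕ := (e.repr x).support

/-- `k < x`, that is `k < min supp x`. -/
def NatLt (e : Module.Basis ℕ 𝕜 E) (k : ℕ) (x : E) : Prop := ∀ i ∈ supp e x, k < i

/-- `x < n`, that is `max supp x < n`. -/
def LtNat (e : Module.Basis ℕ 𝕜 E) (x : E) (n : ℕ) : Prop := ∀ i ∈ supp e x, i < n

/-- `x < y`, that is `max supp x < min supp y`. -/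
def VecLt (e : Module.Basis ℕ 𝕜 E) (x y : E) : Prop :=
  ∀ i ∈ supp e x, ∀ j ∈ supp e y, i < j

/-- The set `bb(eᵢ)` of infinite normalised block sequences. -/
def bb (e : Module.Basis ℕ 𝕜 E) : Set (ℕ → E) :=
  {x | (∀ i, ‖x i‖ = 1) ∧ ∀ i, VecLt e (x i) (x (i + 1))}

/-- The set `fbb(eᵢ)` of finite normalised block sequences. -/
def fbb (e : Module.Basis ℕ 𝕜 E) : Set (List E) :=
  {s | (∀ x ∈ s, ‖x‖ = 1) ∧ s.IsChain (VecLt e)}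

/-- The finite sequence `(x₀, …, xₙ₋₁)`. -/
def initSeg {α : Type*} (x : ℕ → α) (n : ℕ) : List α := List.ofFn fun i : Fin n => x i

/-- `B ⊆ bb(eᵢ)` is coanalytic: its complement in `bb(eᵢ)` is analytic. Here `ℕ → E` carries the
product of the norm topologies. As `E` is the union of the finite-dimensional (closed, Polish)
spaces `[e₀, …, eₙ]`, the Borel sets of the norm topology are exactly those of the standard Borel
structure of this increasing union; `bb(eᵢ)` is a Borel subset of `ℕ → E`. -/
def IsCoanalytic (e : Module.Basis ℕ 𝕜 E) (B : Set (ℕ → E)) : Prop :=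
  AnalyticSet (bb e \ B)

/-- `Δ > 0`: a decreasing sequence of strictly positive reals converging to `0`. -/
def IsDelta (δ : ℕ → ℝ) : Prop :=
  Antitone δ ∧ (∀ i, 0 < δ i) ∧ Tendsto δ atTop (𝓝 0)

/-- The set `Int_Δ(A)`. -/
def IntDelta (e : Module.Basis ℕ 𝕜 E) (δ : ℕ → ℝ) (A : Set (ℕ → E)) : Set (ℕ → E) :=
  {y | y ∈ bb e ∧ ∀ x ∈ bb e, (∀ i, ‖x i - y i‖ < δ i) → x ∈ A}

/-- The relation `R(mᵢ, xᵢ)`: for all `i` there is `j` with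
`m₀ < xᵢ < mⱼ < mⱼ₊₁ < xᵢ₊₁`. -/
def RelR (e : Module.Basis ℕ 𝕜 E) (m : ℕ → ℕ) (x : ℕ → E) : Prop :=
  ∀ i, ∃ j, NatLt e (m 0) (x i) ∧ LtNat e (x i) (m j) ∧ m j < m (j + 1) ∧
    NatLt e (m (j + 1)) (x (i + 1))

/-- Player I has a strategy in the infinite asymptotic game to play in `A`. The strategy `σ`
gives I's next number from II's previous moves; every run of the game in which I follows `σ` and
II obeys the rules (normalised block vectors with `nₖ < xₖ`) has its outcome in `A`. -/
def StrategyI (e : Module.Basis ℕ 𝕜 E) (A : Set (ℕ → E)) : Prop :=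
  ∃ σ : List E → ℕ, ∀ x ∈ bb e, (∀ k, NatLt e (σ (initSeg x k)) (x k)) → x ∈ A

/-- Player II has a strategy in the infinite asymptotic game to play in `A`. The strategy `τ`
gives II's move `xₖ` from the numbers `(n₀, …, nₖ)` played by I; whatever I plays, II obeys the
rules and the outcome is in `A`. -/
def StrategyII (e : Module.Basis ℕ 𝕜 E) (A : Set (ℕ → E)) : Prop :=
  ∃ τ : List ℕ → E, ∀ n : ℕ → ℕ,
    (fun k => τ (initSeg n (k + 1))) ∈ bb e ∧
    (∀ k, NatLt e (n k) (τ (initSeg n (k + 1)))) ∧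
    (fun k => τ (initSeg n (k + 1))) ∈ A

/-- Block trees (of normalised vectors). The successors of every node, the root `∅` included, are
the terms of an infinite normalised block sequence lying beyond the last vector of the node. -/
structure IsBlockTree (e : Module.Basis ℕ 𝕜 E) (T : Set (List E)) : Prop where
  subset_fbb : T ⊆ fbb e
  nonempty : T.Nonempty
  mem_of_isPrefix : ∀ s ∈ T, ∀ t, t <+: s → t ∈ T
  successors : ∀ s ∈ T, ∃ y ∈ bb e, {v | s ++ [v] ∈ T} = range y ∧
    ∀ v ∈ s.getLast?, VecLt e v (y 0)

/-- The set `[T]` of infinite branches of `T`. -/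
def branches (e : Module.Basis ℕ 𝕜 E) (T : Set (List E)) : Set (ℕ → E) :=
  {x | x ∈ bb e ∧ ∀ n, initSeg x n ∈ T}

end AsymptoticGame

/-!
The finite-dimensional unit spheres are compact, so the games may be played with moves in nets of
which only finitely many vectors lie below each `n`, at the cost of a small perturbation. A strategy
of I in such a discretized game then answers the finitely many block sequences below `mⱼ` with a
number bounded by some `mⱼ₊₁`, which turns the strategy into the sequence `(mᵢ)` of (d).

The complement of `B` is the image of a continuous `f : ℕ^ℕ → E^ℕ`, so that II has to produce an
outcome close to some `f κ`. Suppose that I cannot prevent this. II keeps in memory a finite initial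
segment `t` of a future witness `κ` such that, at the time `t` was chosen, I could not prevent an
outcome close to some `f κ` with `κ` extending `t`. Playing against the countably many ways of
lengthening `t` at once, I could take them up one after another; since he fails, II can force a
position at which `t` can be lengthened. In the limit this produces a `κ`, and by continuity the
outcome is close to `f κ`. All outcomes allowed by this strategy form the branches of a tree, from
which a block tree is extracted.
-/

namespace AsymptoticGame

section InitSeg

variable {α : Type*}

@[simp] lemma initSeg_zero (x : ℕ → α) : initSeg x 0 = [] := rfl

@[simp] lemma length_initSeg (x : ℕ → α) (n : ℕ) : (initSeg x n).length = n := by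
  simp [initSeg]

lemma initSeg_succ (x : ℕ → α) (n : ℕ) : initSeg x (n + 1) = initSeg x n ++ [x n] := by
  rw [initSeg, List.ofFn_succ', List.concat_eq_append]
  rfl

lemma getElem_initSeg (x : ℕ → α) {i n : ℕ} (h : i < (initSeg x n).length) :
    (initSeg x n)[i] = x i := by
  simp [initSeg]

lemma take_initSeg (x : ℕ → α) {i n : ℕ} (h : i ≤ n) : (initSeg x n).take i = initSeg x i :=
  List.ext_getElem (by simp [h]) fun j _ _ => by simp [initSeg]

lemma initSeg_eq_iff {x y : ℕ → α} {n : ℕ} :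
    initSeg x n = initSeg y n ↔ ∀ i < n, x i = y i := by
  simp [initSeg, List.ofFn_inj, funext_iff, Fin.forall_iff]

lemma initSeg_eq_of_le {x y : ℕ → α} {m n : ℕ} (h : initSeg x n = initSeg y n) (hmn : m ≤ n) :
    initSeg x m = initSeg y m :=
  initSeg_eq_iff.2 fun i hi => initSeg_eq_iff.1 h i (hi.trans_le hmn)

lemma exists_seq_eq_apply_initSeg (F : List α → α) : ∃ x : ℕ → α, ∀ k, x k = F (initSeg x k) := by
  let L : ℕ → List α := fun k => (fun l => l ++ [F l])^[k] []
  have hL : ∀ k, initSeg (fun k => F (L k)) k = L k := by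
    intro k
    induction k with
    | zero => rfl
    | succ k ih => rw [initSeg_succ, ih, ← Function.iterate_succ_apply' (fun l => l ++ [F l])]
  exact ⟨fun k => F (L k), fun k => by rw [hL]⟩

lemma exists_fold_concat {S : Type*} (a : S) (step : S → List α → α → S) :
    ∃ state : List α → S, state [] = a ∧
      ∀ v x, state (v ++ [x]) = step (state v) v x :=
  ⟨fun l => l.reverseRecOn (motive := fun _ => S) a fun v x b => step b v x, by simp, by simp⟩

lemma exists_seq_of_forall_exists_concat {Q : ℕ → List α → Prop} (h0 : Q 0 [])
    (hQ : ∀ n t, Q n t → ∃ m > n, ∃ k, Q m (t ++ [k])) :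
    ∃ κ : ℕ → α, ∀ j, ∃ i ≥ j, Q i (initSeg κ j) := by
  have hnext : ∀ a : {a : ℕ × List α // Q a.1 a.2}, ∃ b : {b : ℕ × List α // Q b.1 b.2},
      a.1.1 < b.1.1 ∧ ∃ k, b.1.2 = a.1.2 ++ [k] := by
    rintro ⟨⟨n, t⟩, h⟩
    obtain ⟨m, hm, k, hk⟩ := hQ n t h
    exact ⟨⟨(m, t ++ [k]), hk⟩, hm, k, rfl⟩
  choose next hlt κ hκ using hnext
  let a := fun j => next^[j] ⟨(0, []), h0⟩
  have ha : ∀ j, a (j + 1) = next (a j) := fun j => Function.iterate_succ_apply' _ _ _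
  have hseg : ∀ j, j ≤ (a j).1.1 ∧ (a j).1.2 = initSeg (fun j => κ (a j)) j := by
    intro j
    induction j with
    | zero => exact ⟨le_rfl, rfl⟩
    | succ j ih =>
      rw [ha, initSeg_succ, hκ, ih.2]
      exact ⟨ih.1.trans_lt (hlt _), rfl⟩
  exact ⟨fun j => κ (a j), fun j => ⟨_, (hseg j).1, (hseg j).2 ▸ (a j).2⟩⟩

end InitSeg

section FilterGame

variable {α β : Type*} {F : List α → Filter α} {s : List α} {A : Set (ℕ → α)}

/-- The infinite sequences that extend the position `s` and from there on obey `c`, which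
prescribes a set of permitted moves at every position. -/
def plays (c : List α → Set α) (s : List α) : Set (ℕ → α) :=
  {d | initSeg d s.length = s ∧ ∀ i, s.length ≤ i → d i ∈ c (initSeg d i)}

/-- In the filter game given by `F` the players build an infinite sequence: at position `v` the
first player chooses a set `U v ∈ F v` and the second player answers with an element of it.
`FirstWins F s A` says that from `s` the first player can force the outcome into `A`. His choices
depend on the position alone, as he gains nothing from remembering his own moves. -/
def FirstWins (F : List α → Filter α) (s : List α) (A : Set (ℕ → α)) : Prop :=
  ∃ U : List α → Set α, (∀ v, U v ∈ F v) ∧ plays U s ⊆ A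

/-- From `s` the second player can force the outcome of the filter game into `A`. His strategy is
encoded by the set `c v` of all answers it may give at position `v`; a set arises in this way
exactly if it meets every member of `F v`. -/
def SecondWins (F : List α → Filter α) (s : List α) (A : Set (ℕ → α)) : Prop :=
  ∃ c : List α → Set α, (∀ v, ∃ᶠ x in F v, x ∈ c v) ∧ plays c s ⊆ A

lemma SecondWins.mono {A' : Set (ℕ → α)} (h : SecondWins F s A) (hA : A ⊆ A') :
    SecondWins F s A' :=
  let ⟨c, hc, hcA⟩ := h
  ⟨c, hc, hcA.trans hA⟩

lemma exists_mem_of_not_firstWins_compl (h : ¬ FirstWins F s Aᶜ) :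
    ∃ d ∈ A, initSeg d s.length = s := by
  by_contra! hA
  exact h ⟨fun _ => univ, fun _ => univ_mem, fun d hd hdA => hA d hdA hd.1⟩

lemma exists_strategy_of_firstWins (F : List α → Filter α) (s : List α) (A : Set (ℕ → α)) :
    ∃ U : List α → Set α, (∀ v, U v ∈ F v) ∧ (FirstWins F s A → plays U s ⊆ A) := by
  by_cases h : FirstWins F s A
  · exact h.imp fun U hU => ⟨hU.1, fun _ => hU.2⟩
  · exact ⟨fun _ => univ, fun _ => univ_mem, fun h' => absurd h' h⟩

lemma exists_strategy_of_secondWins (F : List α → Filter α) [∀ v, (F v).NeBot] (s : List α)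
    (A : Set (ℕ → α)) :
    ∃ c : List α → Set α, (∀ v, ∃ᶠ x in F v, x ∈ c v) ∧ (SecondWins F s A → plays c s ⊆ A) := by
  by_cases h : SecondWins F s A
  · exact h.imp fun c hc => ⟨hc.1, fun _ => hc.2⟩
  · exact ⟨fun _ => univ, fun _ => Frequently.of_forall mem_univ, fun h' => absurd h' h⟩

lemma SecondWins.of_frequently [∀ v, (F v).NeBot]
    (h : ∃ᶠ x in F s, SecondWins F (s ++ [x]) A) : SecondWins F s A := by
  choose c hc hcA using fun x => exists_strategy_of_secondWins F (s ++ [x]) A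
  refine ⟨fun v => {x | (v = s → SecondWins F (s ++ [x]) A) ∧
    ∀ hv : s.length < v.length, x ∈ c v[s.length] v}, fun v => ?_, fun d ⟨hds, hd⟩ => ?_⟩
  · by_cases hv : s.length < v.length
    · have hvs : v ≠ s := by rintro rfl; exact lt_irrefl _ hv
      exact (hc v[s.length] v).mono fun x hx => ⟨fun h => absurd h hvs, fun _ => hx⟩
    · by_cases hvs : v = s
      · subst hvs
        exact h.mono fun x hx => ⟨fun _ => hx, fun h => absurd h hv⟩
      · exact Frequently.of_forall fun x => ⟨fun h => absurd h hvs, fun h => absurd h hv⟩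
  · refine hcA (d s.length) ((hd _ le_rfl).1 hds) ⟨?_, fun i hi => ?_⟩
    · rw [List.length_append, List.length_singleton, initSeg_succ, hds]
    · rw [List.length_append, List.length_singleton] at hi
      have := (hd i (by lia)).2 (by rwa [length_initSeg])
      rwa [getElem_initSeg] at this

/-- The first player can stay among the positions that are not won by the second player, while a
play in the open set `A` soon reaches a position from which every continuation lies in `A`. -/
theorem firstWins_compl_or_secondWins_of_open [∀ v, (F v).NeBot] (s : List α)
    (hA : ∀ d ∈ A, ∃ n, ∀ d', initSeg d' n = initSeg d n → d' ∈ A) :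
    FirstWins F s Aᶜ ∨ SecondWins F s A := by
  refine or_iff_not_imp_right.2 fun hs =>
    ⟨fun v => {x | ¬ SecondWins F v A → ¬ SecondWins F (v ++ [x]) A}, fun v => ?_,
      fun d ⟨hds, hd⟩ hdA => ?_⟩
  · by_cases hv : SecondWins F v A
    · exact Eventually.of_forall fun x h => absurd hv h
    · exact (not_frequently.1 (mt SecondWins.of_frequently hv)).mono fun x hx _ => hx
  · have hnot : ∀ i, s.length ≤ i → ¬ SecondWins F (initSeg d i) A := by
      intro i hi
      induction i, hi using Nat.le_induction with
      | base => rwa [hds]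
      | succ i hi ih => rw [initSeg_succ]; exact hd i hi ih
    obtain ⟨n, hn⟩ := hA d hdA
    refine hnot (max n s.length) (le_max_right _ _)
      ⟨fun _ => univ, fun _ => Frequently.of_forall mem_univ, fun d' hd' => hn d' ?_⟩
    have hseg := hd'.1
    rw [length_initSeg] at hseg
    exact initSeg_eq_of_le hseg (le_max_left _ _)

/-- To avoid all the sets `A k` the first player may take up the task of avoiding `A k` as late as
at a time `i ≥ k`; then he has only finitely many strategies to follow at each position. -/
lemma FirstWins.compl_iUnion {A : ℕ → Set (ℕ → α)}
    (h : FirstWins F s {d | ∀ i > s.length, ∀ k ≤ i, FirstWins F (initSeg d i) (A k)ᶜ}) :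
    FirstWins F s (⋃ k, A k)ᶜ := by
  obtain ⟨V, hV, hVA⟩ := h
  choose U hU hUA using fun v k => exists_strategy_of_firstWins F v (A k)ᶜ
  refine ⟨fun w => {x | x ∈ V w ∧ ∀ i ∈ Iic w.length, ∀ k ∈ Iic i, x ∈ U (w.take i) k w},
    fun w => ?_, fun d ⟨hds, hd⟩ hdA => ?_⟩
  · exact inter_mem (hV w) <| (eventually_all_finite (finite_Iic _)).2 fun i _ =>
      (eventually_all_finite (finite_Iic _)).2 fun k _ => hU (w.take i) k w
  · obtain ⟨k, hk⟩ := mem_iUnion.1 hdA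
    set i := max k (s.length + 1)
    have hi : s.length < i := Nat.lt_of_succ_le (le_max_right _ _)
    have hwin : FirstWins F (initSeg d i) (A k)ᶜ :=
      hVA ⟨hds, fun l hl => (hd l hl).1⟩ i hi k (le_max_left _ _)
    refine hUA _ k hwin ⟨by rw [length_initSeg], fun l hl => ?_⟩ hk
    rw [length_initSeg] at hl
    have := (hd l (hi.le.trans hl)).2 i (by simpa using hl) k (le_max_left k _)
    rwa [take_initSeg d hl] at this

lemma SecondWins.of_not_firstWins_compl_iUnion [∀ v, (F v).NeBot] {A : ℕ → Set (ℕ → α)}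
    (h : ¬ FirstWins F s (⋃ k, A k)ᶜ) :
    SecondWins F s {d | ∃ i > s.length, ∃ k, ¬ FirstWins F (initSeg d i) (A k)ᶜ} := by
  have hopen := firstWins_compl_or_secondWins_of_open (F := F) s
    (A := {d | ∃ i > s.length, ∃ k ≤ i, ¬ FirstWins F (initSeg d i) (A k)ᶜ})
    fun d ⟨i, hi, k, hk, hd⟩ => ⟨i, fun d' hd' => ⟨i, hi, k, hk, by rwa [hd']⟩⟩
  refine (hopen.resolve_left fun hfirst => h (FirstWins.compl_iUnion ?_)).mono
    fun d ⟨i, hi, k, _, hd⟩ => ⟨i, hi, k, hd⟩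
  convert hfirst using 1
  ext d
  simp

/-- The last good pair is kept in memory and replaced as soon as its second component can be
lengthened. -/
lemma exists_memory {G : List α → List β → Prop} (hnil : G [] []) :
    ∃ mem : List α → {a : List α × List β // G a.1 a.2}, (mem []).1 = ([], []) ∧
      ∀ v x, (∃ k, (mem (v ++ [x])).1 = (v ++ [x], (mem v).1.2 ++ [k])) ∨
        mem (v ++ [x]) = mem v ∧ ∀ k, ¬ G (v ++ [x]) ((mem v).1.2 ++ [k]) := by
  have hstep : ∀ (a : {a : List α × List β // G a.1 a.2}) (v : List α) (x : α),
      ∃ b : {b : List α × List β // G b.1 b.2},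
        (∃ k, b.1 = (v ++ [x], a.1.2 ++ [k])) ∨ b = a ∧ ∀ k, ¬ G (v ++ [x]) (a.1.2 ++ [k]) := by
    intro a v x
    by_cases h : ∃ k, G (v ++ [x]) (a.1.2 ++ [k])
    · exact ⟨⟨_, h.choose_spec⟩, .inl ⟨_, rfl⟩⟩
    · exact ⟨a, .inr ⟨rfl, not_exists.1 h⟩⟩
  choose step hstep using hstep
  obtain ⟨mem, hmem_nil, hmem⟩ := exists_fold_concat ⟨([], []), hnil⟩ step
  exact ⟨mem, congrArg Subtype.val hmem_nil, fun v x => hmem v x ▸ hstep _ v x⟩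

lemma exists_later_update {G : List α → List β → Prop} {d : ℕ → α}
    {p : ℕ → {a : List α × List β // G a.1 a.2}}
    (hp : ∀ n, (∃ k, (p (n + 1)).1 = (initSeg d (n + 1), (p n).1.2 ++ [k])) ∨
      p (n + 1) = p n ∧ ∀ k, ¬ G (initSeg d (n + 1)) ((p n).1.2 ++ [k])) {n : ℕ}
    (hn : (∀ m ≥ n, p m = p n) → ∃ i > n, ∃ k, G (initSeg d i) ((p n).1.2 ++ [k])) :
    ∃ m > n, ∃ k, (p m).1 = (initSeg d m, (p n).1.2 ++ [k]) := by
  by_contra! hstuck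
  have hconst : ∀ m ≥ n, p m = p n := by
    intro m hm
    induction m, hm using Nat.le_induction with
    | base => rfl
    | succ m hm ih =>
      rcases hp m with ⟨k, hk⟩ | ⟨h, _⟩
      · exact absurd (ih ▸ hk) (hstuck _ (by lia) k)
      · rw [h, ih]
  obtain ⟨i, hi, k, hk⟩ := hn hconst
  obtain ⟨l, rfl⟩ : ∃ l, i = l + 1 := ⟨i - 1, by lia⟩
  have hl : p l = p n := hconst l (by lia)
  rcases hp l with ⟨k', hk'⟩ | ⟨_, h⟩
  · exact hstuck _ hi k' (hl ▸ hk')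
  · exact h k (hl ▸ hk)

/-- The second player follows the strategy belonging to the pair in his memory, which therefore
cannot stay the same forever. -/
lemma SecondWins.of_forall_concat {G : List α → List β → Prop} (hnil : G [] [])
    (hG : ∀ s t, G s t →
      SecondWins F s {d | ∃ i > s.length, ∃ k, G (initSeg d i) (t ++ [k])}) :
    SecondWins F [] {d | ∃ κ : ℕ → β, ∀ j, ∃ i ≥ j, G (initSeg d i) (initSeg κ j)} := by
  obtain ⟨mem, hmem_nil, hmem⟩ := exists_memory hnil
  choose c hc hcG using fun a : {a : List α × List β // G a.1 a.2} => hG a.1.1 a.1.2 a.2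
  refine ⟨fun v => c (mem v) v, fun v => hc _ v, fun d ⟨_, hd⟩ => ?_⟩
  let p := fun n => mem (initSeg d n)
  have hp : ∀ n, (∃ k, (p (n + 1)).1 = (initSeg d (n + 1), (p n).1.2 ++ [k])) ∨
      p (n + 1) = p n ∧ ∀ k, ¬ G (initSeg d (n + 1)) ((p n).1.2 ++ [k]) :=
    fun n => by simpa only [p, initSeg_succ] using hmem (initSeg d n) (d n)
  have hadvance : ∀ n t, (p n).1 = (initSeg d n, t) →
      ∃ m > n, ∃ k, (p m).1 = (initSeg d m, t ++ [k]) := by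
    intro n t hn
    have hnext := exists_later_update hp (n := n) fun hconst => by
      have hlen : (p n).1.1.length = n := by rw [hn, length_initSeg]
      have hplay : d ∈ plays (c (p n)) (p n).1.1 :=
        ⟨by rw [hlen, hn], fun i hi => hconst i (hlen ▸ hi) ▸ hd i (Nat.zero_le i)⟩
      simpa only [mem_ofPred_eq, hlen] using hcG (p n) hplay
    rwa [hn] at hnext
  obtain ⟨κ, hκ⟩ := exists_seq_of_forall_exists_concat hmem_nil hadvance
  refine ⟨κ, fun j => (hκ j).imp fun i ⟨hij, hi⟩ => ⟨hij, ?_⟩⟩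
  have := (p i).2
  rwa [hi] at this

/-- A form of determinacy for analytic games: the second set is the projection of the closure of `P`
with respect to the discrete topology on `α`. -/
theorem firstWins_or_secondWins_of_witness [∀ v, (F v).NeBot] (P : (ℕ → α) → (ℕ → ℕ) → Prop) :
    FirstWins F [] {d | ∃ κ, P d κ}ᶜ ∨ SecondWins F [] {d | ∃ κ, ∀ n, ∃ d' κ',
      initSeg d' n = initSeg d n ∧ initSeg κ' n = initSeg κ n ∧ P d' κ'} := by
  let A : List ℕ → Set (ℕ → α) := fun t => {d | ∃ κ, initSeg κ t.length = t ∧ P d κ}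
  have hA_nil : A [] = {d | ∃ κ, P d κ} := by simp [A]
  have hA_concat : ∀ t, ⋃ k, A (t ++ [k]) = A t := by
    intro t
    ext d
    simp only [A, mem_iUnion, List.length_append, List.length_singleton, initSeg_succ]
    constructor
    · rintro ⟨k, κ, hκ, hP⟩
      exact ⟨κ, (List.append_inj' hκ rfl).1, hP⟩
    · rintro ⟨κ, hκ, hP⟩
      exact ⟨κ t.length, κ, by rw [hκ], hP⟩
  refine or_iff_not_imp_left.2 fun h => ?_
  rw [← hA_nil] at h
  refine (SecondWins.of_forall_concat (G := fun s t => ¬ FirstWins F s (A t)ᶜ) h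
    fun s t hst => ?_).mono fun d ⟨κ, hκ⟩ => ⟨κ, fun n => ?_⟩
  · rw [← hA_concat t] at hst
    exact .of_not_firstWins_compl_iUnion hst
  · obtain ⟨i, hi, hwin⟩ := hκ n
    obtain ⟨d', ⟨κ', hκ', hP⟩, hd'⟩ := exists_mem_of_not_firstWins_compl hwin
    rw [length_initSeg] at hd' hκ'
    exact ⟨d', κ', initSeg_eq_of_le hd' hi, hκ', hP⟩

end FilterGame

variable {𝕜 E : Type*} [RCLike 𝕜] [NormedAddCommGroup E] [NormedSpace 𝕜 E]
  {e : Module.Basis ℕ 𝕜 E}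

section Blocks

lemma NatLt.mono {m n : ℕ} {x : E} (h : NatLt e n x) (hmn : m ≤ n) : NatLt e m x :=
  fun i hi => hmn.trans_lt (h i hi)

lemma supp_nonempty {x : E} (hx : ‖x‖ = 1) : (supp e x).Nonempty := by
  have hx0 : x ≠ 0 := norm_ne_zero_iff.1 (hx ▸ one_ne_zero)
  simpa [supp] using hx0

lemma exists_ltNat (e : Module.Basis ℕ 𝕜 E) (x : E) : ∃ n, LtNat e x n :=
  ⟨(supp e x).sup id + 1, fun _ hi => Nat.lt_succ_of_le (Finset.le_sup (f := id) hi)⟩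

lemma LtNat.vecLt {x y : E} {n : ℕ} (hx : LtNat e x n) (hy : NatLt e n y) : VecLt e x y :=
  fun i hi j hj => (hx i hi).trans (hy j hj)

lemma VecLt.ltNat {x y : E} {n : ℕ} (h : VecLt e x y) (hy : ‖y‖ = 1) (hn : LtNat e y n) :
    LtNat e x n := by
  obtain ⟨j, hj⟩ := supp_nonempty (e := e) hy
  exact fun i hi => (h i hi j hj).trans (hn j hj)

lemma le_of_mem_supp {x : ℕ → E} (hx : x ∈ bb e) (i : ℕ) : ∀ l ∈ supp e (x i), i ≤ l := by
  induction i with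
  | zero => exact fun l _ => Nat.zero_le l
  | succ i ih =>
    intro l hl
    obtain ⟨j, hj⟩ := supp_nonempty (e := e) (hx.1 i)
    exact (ih j hj).trans_lt (hx.2 i j hj l hl)

lemma natLt_succ {x : ℕ → E} (hx : x ∈ bb e) (n : ℕ) : NatLt e n (x (n + 1)) :=
  le_of_mem_supp hx (n + 1)

lemma lt_of_ltNat {x : ℕ → E} (hx : x ∈ bb e) {i n : ℕ} (h : LtNat e (x i) n) : i < n := by
  obtain ⟨l, hl⟩ := supp_nonempty (e := e) (hx.1 i)
  exact (le_of_mem_supp hx i l hl).trans_lt (h l hl)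

lemma LtNat.of_index_le {x : ℕ → E} (hx : x ∈ bb e) {n i l : ℕ} (h : LtNat e (x i) n)
    (hli : l ≤ i) : LtNat e (x l) n := by
  induction i, hli using Nat.le_induction with
  | base => exact h
  | succ i _ ih => exact ih ((hx.2 i).ltNat (hx.1 _) h)

lemma mem_bb_of_initSeg_mem_fbb {x : ℕ → E} (h : ∀ n, initSeg x n ∈ fbb e) : x ∈ bb e := by
  refine ⟨fun i => (h (i + 1)).1 _ (by simp [initSeg_succ]), fun i => ?_⟩
  have := (h (i + 2)).2
  rw [initSeg_succ, initSeg_succ, List.append_assoc, List.isChain_append] at this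
  simpa using this.2.1

lemma mem_bb_of_supp_eq {x y : ℕ → E} (hx : x ∈ bb e) (hy : ∀ i, ‖y i‖ = 1)
    (h : ∀ i, supp e (y i) = supp e (x i)) : y ∈ bb e :=
  ⟨hy, fun i => by simpa only [VecLt, h] using hx.2 i⟩

lemma relR_congr {m : ℕ → ℕ} {x y : ℕ → E} (h : ∀ i, supp e (x i) = supp e (y i)) :
    RelR e m x ↔ RelR e m y := by
  simp only [RelR, NatLt, LtNat, h]

lemma IsDelta.div_const {δ : ℕ → ℝ} (hδ : IsDelta δ) {c : ℝ} (hc : 0 < c) :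
    IsDelta fun i => δ i / c :=
  ⟨fun _ _ hij => div_le_div_of_nonneg_right (hδ.1 hij) hc.le, fun i => div_pos (hδ.2.1 i) hc,
    by simpa using hδ.2.2.div_const c⟩

end Blocks

section FarOut

/-- The filter on `E` of the sets that contain all vectors beyond some `n`. The infinite asymptotic
game, with the vectors restricted to a set `D`, is the filter game of `farOut e ⊓ 𝓟 D`. -/
def farOut (e : Module.Basis ℕ 𝕜 E) : Filter E := ⨅ n, 𝓟 {x | NatLt e n x}

lemma hasBasis_farOut (e : Module.Basis ℕ 𝕜 E) :
    (farOut e).HasBasis (fun _ => True) fun n => {x | NatLt e n x} :=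
  hasBasis_iInf_principal <| Antitone.directed_ge fun _ _ hmn _ hx => hx.mono hmn

lemma eventually_vecLt_farOut (e : Module.Basis ℕ 𝕜 E) (w : E) :
    ∀ᶠ x in farOut e, VecLt e w x := by
  obtain ⟨n, hn⟩ := exists_ltNat e w
  exact (hasBasis_farOut e).eventually_iff.2 ⟨n, trivial, fun _ hx => hn.vecLt hx⟩

lemma frequently_farOut_norm_eq_one (he : ∀ i, ‖e i‖ = 1) : ∃ᶠ x in farOut e, ‖x‖ = 1 :=
  (hasBasis_farOut e).frequently_iff.2 fun {n} _ => ⟨e (n + 1), fun i hi => by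
    rw [supp, Module.Basis.repr_self] at hi
    rw [Finset.mem_singleton.1 (Finsupp.support_single_subset hi)]
    exact n.lt_succ_self, he _⟩

lemma exists_bb_of_frequently_farOut {S : Set E} (hS : ∃ᶠ x in farOut e, x ∈ S)
    (hnorm : ∀ x ∈ S, ‖x‖ = 1) : ∃ y ∈ bb e, ∀ i, y i ∈ S := by
  choose next hnext hS' using fun w => (hS.and_eventually (eventually_vecLt_farOut e w)).exists
  refine ⟨fun i => next (next^[i] 0), ⟨fun i => hnorm _ (hnext _), fun i => ?_⟩, fun i => hnext _⟩
  beta_reduce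
  rw [Function.iterate_succ_apply']
  exact hS' _

end FarOut

section Trees

variable {T : Set (List E)}

/-- The finite sequences all of whose terms are permitted by `c`, which prescribes a set of
permitted moves at every position: the tree whose infinite branches are `plays c []`. -/
def finitePlays {α : Type*} (c : List α → Set α) : Set (List α) :=
  {s | ∀ t x, t ++ [x] <+: s → x ∈ c t}

lemma concat_mem_finitePlays {α : Type*} {c : List α → Set α} {s : List α} {v : α} :
    s ++ [v] ∈ finitePlays c ↔ s ∈ finitePlays c ∧ v ∈ c s := by
  constructor
  · exact fun h => ⟨fun t x ht => h t x (ht.trans (s.prefix_append [v])),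
      h s v (List.prefix_refl _)⟩
  · rintro ⟨hs, hv⟩ t x ht
    rcases List.prefix_concat_iff.1 ht with h | h
    · obtain ⟨rfl, hx⟩ := List.append_inj' h rfl
      rwa [List.singleton_inj.1 hx]
    · exact hs t x h

lemma isBlockTree_finitePlays {y : List E → ℕ → E} (hy : ∀ s, y s ∈ bb e)
    (hlast : ∀ s, ∀ v ∈ s.getLast?, ∀ i, VecLt e v (y s i)) :
    IsBlockTree e (finitePlays fun s => range (y s)) where
  subset_fbb s hs := by
    induction s using List.reverseRecOn with
    | nil => exact ⟨by simp, List.isChain_nil⟩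
    | append_singleton s v ih =>
      obtain ⟨hs', i, rfl⟩ := concat_mem_finitePlays.1 hs
      obtain ⟨hnorm, hchain⟩ := ih hs'
      refine ⟨fun x hx => ?_, List.isChain_append.2 ⟨hchain, List.isChain_singleton _, ?_⟩⟩
      · rcases List.mem_append.1 hx with hx | hx
        · exact hnorm x hx
        · rw [List.mem_singleton.1 hx]
          exact (hy s).1 i
      · rintro v hv _ ⟨⟩
        exact hlast s v hv i
  nonempty := ⟨[], fun t x h => by simp at h⟩
  mem_of_isPrefix s hs t ht u x hu := hs u x (hu.trans ht)
  successors s hs := by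
    refine ⟨y s, hy s, ?_, fun v hv => hlast s v hv 0⟩
    ext v
    simp only [mem_ofPred_eq, concat_mem_finitePlays, hs, true_and]

lemma exists_isBlockTree_of_frequently_farOut {c : List E → Set E}
    (hc : ∀ s, ∃ᶠ x in farOut e, x ∈ c s) (hnorm : ∀ s, ∀ x ∈ c s, ‖x‖ = 1) :
    ∃ T, IsBlockTree e T ∧ branches e T ⊆ plays c [] := by
  have hbeyond : ∀ s, ∃ᶠ x in farOut e, x ∈ {x ∈ c s | ∀ v ∈ s.getLast?, VecLt e v x} := by
    intro s
    refine (hc s).and_eventually ?_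
    cases s.getLast? with
    | none => simp
    | some v => simpa using eventually_vecLt_farOut e v
  choose y hy hyc using fun s =>
    exists_bb_of_frequently_farOut (hbeyond s) fun x hx => hnorm s x hx.1
  refine ⟨_, isBlockTree_finitePlays hy fun s v hv i => (hyc s i).2 v hv,
    fun x hx => ⟨rfl, fun i _ => ?_⟩⟩
  have hi := hx.2 (i + 1)
  rw [initSeg_succ, concat_mem_finitePlays] at hi
  obtain ⟨j, hj⟩ := hi.2
  exact hj ▸ (hyc _ j).1

lemma SecondWins.exists_isBlockTree {D : ℕ → Set E} {A : Set (ℕ → E)}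
    (hA : SecondWins (fun s => farOut e ⊓ 𝓟 (D s.length)) [] A)
    (hnorm : ∀ i, ∀ x ∈ D i, ‖x‖ = 1) : ∃ T, IsBlockTree e T ∧ branches e T ⊆ A := by
  obtain ⟨c, hc, hcA⟩ := hA
  obtain ⟨T, hT, hTc⟩ := exists_isBlockTree_of_frequently_farOut (e := e)
    (c := fun s => D s.length ∩ c s)
    (fun s => (frequently_inf_principal.1 (hc s)).mono fun x hx => hx)
    fun s x hx => hnorm _ x hx.1
  exact ⟨T, hT, fun x hx => hcA ⟨rfl, fun i hi => ((hTc hx).2 i hi).2⟩⟩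

lemma IsBlockTree.nil_mem (hT : IsBlockTree e T) : [] ∈ T := by
  obtain ⟨s, hs⟩ := hT.nonempty
  exact hT.mem_of_isPrefix s hs [] s.nil_prefix

lemma IsBlockTree.exists_concat_mem (hT : IsBlockTree e T) {s : List E} (hs : s ∈ T) (n : ℕ) :
    ∃ v, s ++ [v] ∈ T ∧ NatLt e n v := by
  obtain ⟨y, hy, hrange, -⟩ := hT.successors s hs
  exact ⟨y (n + 1), hrange.superset (mem_range_self _), natLt_succ hy n⟩

lemma IsBlockTree.mem_branches (hT : IsBlockTree e T) {x : ℕ → E} (h : ∀ n, initSeg x n ∈ T) :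
    x ∈ branches e T :=
  ⟨mem_bb_of_initSeg_mem_fbb fun n => hT.subset_fbb (h n), h⟩

end Trees

section Strategies

variable {A A' : Set (ℕ → E)}

lemma StrategyII.mono (h : StrategyII e A) (hA : A ⊆ A') : StrategyII e A' :=
  h.imp fun _ hτ n => ⟨(hτ n).1, (hτ n).2.1, hA (hτ n).2.2⟩

lemma IsBlockTree.strategyII_branches {T : Set (List E)} (hT : IsBlockTree e T) :
    StrategyII e (branches e T) := by
  choose next hnextT hnext using fun (s : T) n => hT.exists_concat_mem s.2 n
  obtain ⟨pos, hpos_nil, hpos⟩ := exists_fold_concat (⟨[], hT.nil_mem⟩ : T)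
    fun s (_ : List ℕ) n => ⟨s ++ [next s n], hnextT s n⟩
  refine ⟨fun l => (pos l).1.getLastD 0, fun n => ?_⟩
  have hmove : ∀ k, (pos (initSeg n (k + 1))).1.getLastD 0 = next (pos (initSeg n k)) (n k) := by
    intro k
    rw [initSeg_succ, hpos, List.getLastD_concat]
  simp only [hmove]
  have hseg : ∀ k, initSeg (fun k => next (pos (initSeg n k)) (n k)) k = pos (initSeg n k) := by
    intro k
    induction k with
    | zero => rw [initSeg_zero, initSeg_zero, hpos_nil]
    | succ k ih => rw [initSeg_succ, ih, initSeg_succ, hpos]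
  have hbranch := hT.mem_branches fun k => hseg k ▸ (pos (initSeg n k)).2
  exact ⟨hbranch.1, fun k => hnext _ _, hbranch⟩

/-- Playing the two strategies against each other gives an outcome in both sets. -/
lemma StrategyI.inter_nonempty (hA : StrategyI e A) (hA' : StrategyII e A') :
    (A ∩ A').Nonempty := by
  obtain ⟨σ, hσ⟩ := hA
  obtain ⟨τ, hτ⟩ := hA'
  obtain ⟨n, hn⟩ := exists_seq_eq_apply_initSeg fun l : List ℕ =>
    σ (initSeg (fun i => τ (l.take (i + 1))) l.length)
  obtain ⟨hbb, hlegal, hmem⟩ := hτ n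
  refine ⟨_, hσ _ hbb fun k => ?_, hmem⟩
  have hk : initSeg (fun i => τ ((initSeg n k).take (i + 1))) (initSeg n k).length =
      initSeg (fun k => τ (initSeg n (k + 1))) k := by
    rw [length_initSeg]
    exact initSeg_eq_iff.2 fun i hi => by rw [take_initSeg n (Nat.succ_le_of_lt hi)]
  have hlegal_k := hlegal k
  rwa [hn k, hk] at hlegal_k

lemma StrategyI.branches_inter_nonempty (hA : StrategyI e A) {T : Set (List E)}
    (hT : IsBlockTree e T) : (branches e T ∩ A).Nonempty :=
  inter_comm A _ ▸ hA.inter_nonempty hT.strategyII_branches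

lemma StrategyI.not_strategyII_sdiff (hA : StrategyI e A) {C : Set (ℕ → E)} :
    ¬ StrategyII e (C \ A) := fun hII =>
  let ⟨_, hx, hx'⟩ := hA.inter_nonempty hII
  hx'.2 hx

/-- After `x` player I plays `m (j + 1)` for some `j` with `x < m j`. -/
lemma strategyI_of_relR {m : ℕ → ℕ} (hm : StrictMono m)
    (h : ∀ x ∈ bb e, RelR e m x → x ∈ A) : StrategyI e A := by
  have hj : ∀ x : E, ∃ j, LtNat e x (m j) := fun x =>
    (exists_ltNat e x).imp fun n hn i hi => (hn i hi).trans_le (hm.id_le n)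
  choose j hj using hj
  refine ⟨fun s => s.getLast?.elim (m 0) fun x => m (j x + 1), fun x hx hσ => ?_⟩
  have hsucc : ∀ i, NatLt e (m (j (x i) + 1)) (x (i + 1)) := fun i => by
    simpa [initSeg_succ] using hσ (i + 1)
  refine h x hx fun i => ⟨j (x i), ?_, hj _, hm (Nat.lt_succ_self _), hsucc i⟩
  cases i with
  | zero => simpa using hσ 0
  | succ i => exact (hsucc i).mono (hm.monotone (Nat.zero_le _))

end Strategies

section Discretization

lemma finite_setOf_initSeg {α : Type*} {S : ℕ → Set α} (hS : ∀ i, (S i).Finite) (n : ℕ) :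
    {s | ∃ k ≤ n, ∃ d, (∀ i < k, d i ∈ S i) ∧ initSeg d k = s}.Finite := by
  have hfin :
      (⋃ k ∈ Iic n, (fun d : Fin k → α => List.ofFn d) '' Set.pi univ fun i => S i).Finite :=
    (finite_Iic n).biUnion fun k _ => (Set.Finite.pi fun i : Fin k => hS i).image _
  refine hfin.subset ?_
  rintro _ ⟨k, hk, d, hd, rfl⟩
  exact mem_biUnion hk ⟨_, fun i _ => hd i i.2, rfl⟩

/-- `m (j + 1)` bounds the numbers `M s` for the finitely many `s` that lie below `m j`. -/
lemma exists_strictMono_forall_relR_natLt {D : ℕ → Set E}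
    (hfin : ∀ i n, {x ∈ D i | LtNat e x n}.Finite) (M : List E → ℕ) :
    ∃ m : ℕ → ℕ, StrictMono m ∧ ∀ d ∈ bb e, (∀ i, d i ∈ D i) → RelR e m d →
      ∀ i, NatLt e (M (initSeg d i)) (d i) := by
  choose b hb using fun n => ((finite_setOf_initSeg (hfin · n) n).image M).bddAbove
  let m : ℕ → ℕ := fun j => (fun n => max (n + 1) (b n))^[j] (M [])
  have hm : ∀ j, m (j + 1) = max (m j + 1) (b (m j)) := fun j =>
    Function.iterate_succ_apply' _ j _
  refine ⟨m, strictMono_nat_of_lt_succ fun j => ?_, fun d hd hdD hR i => ?_⟩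
  · rw [hm]
    exact (Nat.lt_succ_self _).trans_le (le_max_left _ _)
  cases i with
  | zero =>
    obtain ⟨j, h, -⟩ := hR 0
    exact h
  | succ i =>
    obtain ⟨j, -, hlt, -, hgt⟩ := hR i
    have hbound : M (initSeg d (i + 1)) ≤ b (m j) := hb (m j) <| mem_image_of_mem M
      ⟨i + 1, lt_of_ltNat hd hlt, d, fun l hl => ⟨hdD l, hlt.of_index_le hd (by lia)⟩, rfl⟩
    exact hgt.mono (hbound.trans (hm j ▸ le_max_right _ _))

lemma FirstWins.exists_strictMono_forall_relR_mem {D : ℕ → Set E} {A : Set (ℕ → E)}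
    (hA : FirstWins (fun s => farOut e ⊓ 𝓟 (D s.length)) [] A)
    (hfin : ∀ i n, {x ∈ D i | LtNat e x n}.Finite) :
    ∃ m : ℕ → ℕ, StrictMono m ∧ ∀ d ∈ bb e, (∀ i, d i ∈ D i) → RelR e m d → d ∈ A := by
  obtain ⟨U, hU, hUA⟩ := hA
  choose M _ hM using fun s => ((hasBasis_farOut e).inf_principal _).mem_iff.1 (hU s)
  obtain ⟨m, hm, hmM⟩ := exists_strictMono_forall_relR_natLt hfin M
  refine ⟨m, hm, fun d hd hdD hR => hUA ⟨rfl, fun i _ => hM _ ⟨hmM d hd hdD hR i, ?_⟩⟩⟩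
  rw [length_initSeg]
  exact hdD i

lemma totallyBounded_setOf_supp_eq (e : Module.Basis ℕ 𝕜 E) (F : Finset ℕ) :
    TotallyBounded {x | ‖x‖ = 1 ∧ supp e x = F} := by
  let V : Submodule 𝕜 E := Submodule.span 𝕜 (e '' F)
  have : FiniteDimensional 𝕜 V := FiniteDimensional.span_of_finite 𝕜 (F.finite_toSet.image e)
  have : ProperSpace V := FiniteDimensional.proper_rclike 𝕜 V
  have hcompact : IsCompact ((↑) '' Metric.closedBall (0 : V) 1 : Set E) :=
    (isCompact_closedBall (0 : V) 1).image continuous_subtype_val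
  refine hcompact.totallyBounded.subset ?_
  rintro x ⟨hx, rfl⟩
  exact ⟨⟨x, e.mem_span_repr_support x⟩, by simp [hx], rfl⟩

lemma exists_locallyFinite_net (e : Module.Basis ℕ 𝕜 E) {ε : ℝ} (hε : 0 < ε) :
    ∃ D : Set E, (∀ x ∈ D, ‖x‖ = 1) ∧ (∀ n, {x ∈ D | LtNat e x n}.Finite) ∧
      ∀ x, ‖x‖ = 1 → ∃ y ∈ D, supp e y = supp e x ∧ ‖x - y‖ < ε := by
  choose G hG hfin hcov using fun F =>
    Metric.finite_approx_of_totallyBounded (totallyBounded_setOf_supp_eq e F) ε hε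
  refine ⟨⋃ F, G F, fun x hx => ?_, fun n => ?_, fun x hx => ?_⟩
  · obtain ⟨F, hF⟩ := mem_iUnion.1 hx
    exact (hG F hF).1
  · refine ((Finset.range n).powerset.finite_toSet.biUnion fun F _ => hfin F).subset ?_
    rintro x ⟨hx, hxn⟩
    obtain ⟨F, hF⟩ := mem_iUnion.1 hx
    obtain rfl := (hG F hF).2
    exact mem_biUnion (Finset.mem_powerset.2 fun i hi => Finset.mem_range.2 (hxn i hi)) hF
  · obtain ⟨y, hy, hxy⟩ := mem_iUnion₂.1 (hcov _ ⟨hx, rfl⟩)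
    exact ⟨y, mem_iUnion.2 ⟨_, hy⟩, (hG _ hy).2, by rwa [← dist_eq_norm]⟩

end Discretization

section Dichotomy

lemma dist_le_of_forall_initSeg {X : Type*} [PseudoMetricSpace X] {f : (ℕ → ℕ) → ℕ → X}
    (hf : Continuous f) {ε : ℕ → ℝ} {x : ℕ → X} {κ : ℕ → ℕ}
    (h : ∀ n, ∃ x' κ', initSeg x' n = initSeg x n ∧ initSeg κ' n = initSeg κ n ∧
      ∀ i, dist (f κ' i) (x' i) ≤ ε i) (i : ℕ) : dist (f κ i) (x i) ≤ ε i := by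
  choose x' ξ hx' hξ hdist using h
  have hlim : Tendsto ξ atTop (𝓝 κ) := tendsto_pi_nhds.2 fun a =>
    tendsto_const_nhds.congr' <| (eventually_gt_atTop a).mono fun n hn =>
      (initSeg_eq_iff.1 (hξ n) a hn).symm
  have hlim_dist : Tendsto (fun n => dist (f (ξ n) i) (x i)) atTop (𝓝 (dist (f κ i) (x i))) :=
    (((continuous_apply i).comp hf).tendsto κ |>.comp hlim).dist tendsto_const_nhds
  exact le_of_tendsto hlim_dist <| (eventually_gt_atTop i).mono fun n hn =>
    initSeg_eq_iff.1 (hx' n) i hn ▸ hdist n i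

variable {B : Set (ℕ → E)} {δ : ℕ → ℝ} {D : ℕ → Set E} {f : (ℕ → ℕ) → ℕ → E}

lemma FirstWins.exists_relR (hnorm : ∀ i, ∀ x ∈ D i, ‖x‖ = 1)
    (hfin : ∀ i n, {x ∈ D i | LtNat e x n}.Finite)
    (happrox : ∀ i x, ‖x‖ = 1 → ∃ y ∈ D i, supp e y = supp e x ∧ ‖x - y‖ < δ i / 4)
    (hf : bb e \ B ⊆ range f)
    (h : FirstWins (fun s => farOut e ⊓ 𝓟 (D s.length)) []
      {d | ∃ κ, ∀ i, dist (f κ i) (d i) ≤ δ i / 2}ᶜ) :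
    ∃ m : ℕ → ℕ, StrictMono m ∧
      ∀ x ∈ bb e, RelR e m x → x ∈ IntDelta e (fun i => δ i / 4) B := by
  obtain ⟨m, hm, hmem⟩ := h.exists_strictMono_forall_relR_mem hfin
  refine ⟨m, hm, fun x hx hR => ⟨hx, fun z hz hzx => ?_⟩⟩
  by_contra hzB
  obtain ⟨κ, rfl⟩ := hf ⟨hz, hzB⟩
  choose d hdD hsupp hxd using fun i => happrox i (x i) (hx.1 i)
  have hd : d ∈ bb e := mem_bb_of_supp_eq hx (fun i => hnorm i _ (hdD i)) hsupp
  refine hmem d hd hdD ((relR_congr hsupp).2 hR) ⟨κ, fun i => ?_⟩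
  have hzx_i := hzx i
  have hxd_i := hxd i
  rw [← dist_eq_norm] at hzx_i hxd_i
  linarith [dist_triangle (f κ i) (x i) (d i)]

lemma SecondWins.exists_branches_subset_sdiff (hδ : ∀ i, 0 < δ i)
    (hnorm : ∀ i, ∀ x ∈ D i, ‖x‖ = 1) (hf : Continuous f) (hfB : range f ⊆ bb e \ B)
    (h : SecondWins (fun s => farOut e ⊓ 𝓟 (D s.length)) [] {d | ∃ κ, ∀ n, ∃ d' κ',
      initSeg d' n = initSeg d n ∧ initSeg κ' n = initSeg κ n ∧
        ∀ i, dist (f κ' i) (d' i) ≤ δ i / 2}) :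
    ∃ T, IsBlockTree e T ∧ branches e T ⊆ bb e \ IntDelta e δ B := by
  obtain ⟨T, hT, hTA⟩ := h.exists_isBlockTree hnorm
  refine ⟨T, hT, fun d hd => ⟨hd.1, fun hint => ?_⟩⟩
  obtain ⟨κ, hκ⟩ := hTA hd
  obtain ⟨hbb, hnot⟩ := hfB (mem_range_self κ)
  refine hnot (hint.2 _ hbb fun i => ?_)
  rw [← dist_eq_norm]
  exact (dist_le_of_forall_initSeg hf hκ i).trans_lt (half_lt_self (hδ i))

lemma farOut_inf_principal_neBot (he : ∀ i, ‖e i‖ = 1) {S : Set E}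
    (hS : ∀ x, ‖x‖ = 1 → ∃ y ∈ S, supp e y = supp e x) : (farOut e ⊓ 𝓟 S).NeBot := by
  refine frequently_mem_iff_neBot.1 ((hasBasis_farOut e).frequently_iff.2 fun {n} _ => ?_)
  obtain ⟨x, hxn, hx⟩ :=
    (hasBasis_farOut e).frequently_iff.1 (frequently_farOut_norm_eq_one he) (i := n) trivial
  obtain ⟨y, hy, hsupp⟩ := hS x hx
  exact ⟨y, fun i hi => hxn i (hsupp ▸ hi), hy⟩

theorem exists_relR_or_exists_isBlockTree (he : ∀ i, ‖e i‖ = 1) (hB : IsCoanalytic e B)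
    (hδ : ∀ i, 0 < δ i) :
    (∃ m : ℕ → ℕ, StrictMono m ∧
      ∀ x ∈ bb e, RelR e m x → x ∈ IntDelta e (fun i => δ i / 4) B) ∨
    ∃ T, IsBlockTree e T ∧ branches e T ⊆ bb e \ IntDelta e δ B := by
  rw [IsCoanalytic, AnalyticSet] at hB
  rcases hB with hB | ⟨f, hf, hfB⟩
  · exact .inl ⟨id, strictMono_id, fun x hx _ => ⟨hx, fun z hz _ => sdiff_eq_empty.1 hB hz⟩⟩
  choose D hnorm hfin happrox using fun i => exists_locallyFinite_net e (div_pos (hδ i) four_pos)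
  have : ∀ s : List E, (farOut e ⊓ 𝓟 (D s.length)).NeBot := fun s =>
    farOut_inf_principal_neBot he fun x hx =>
      (happrox s.length x hx).imp fun _ hy => ⟨hy.1, hy.2.1⟩
  exact (firstWins_or_secondWins_of_witness fun d κ => ∀ i, dist (f κ i) (d i) ≤ δ i / 2).imp
    (fun h => h.exists_relR hnorm hfin happrox hfB.ge)
    fun h => h.exists_branches_subset_sdiff hδ hnorm hf hfB.le

end Dichotomy

end AsymptoticGame

open AsymptoticGame in
theorem mainTheorem5 {𝕜 E : Type*} [RCLike 𝕜] [NormedAddCommGroup E] [NormedSpace 𝕜 E]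
    (e : Module.Basis ℕ 𝕜 E) (he : ∀ i, ‖e i‖ = 1)
    (B : Set (ℕ → E)) (hB : B ⊆ bb e) (hBco : IsCoanalytic e B) :
    [∃ δ, IsDelta δ ∧ ∃ m : ℕ → ℕ, StrictMono m ∧
        ∀ x ∈ bb e, RelR e m x → x ∈ IntDelta e δ B,
      ∃ δ, IsDelta δ ∧ StrategyI e (IntDelta e δ B),
      ∃ δ, IsDelta δ ∧ ∀ T, IsBlockTree e T →
        (branches e T ∩ IntDelta e δ B).Nonempty].TFAE ∧
    ((¬ ∃ δ, IsDelta δ ∧ StrategyI e (IntDelta e δ B)) ↔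
      ∀ δ, IsDelta δ → StrategyII e (bb e \ IntDelta e δ B)) := by
  have hdich {δ} (hδ : IsDelta δ) := exists_relR_or_exists_isBlockTree he hBco hδ.2.1
  constructor
  · tfae_have 1 → 2
    | ⟨δ, hδ, m, hm, h⟩ => ⟨δ, hδ, strategyI_of_relR hm h⟩
    tfae_have 2 → 3
    | ⟨δ, hδ, hI⟩ => ⟨δ, hδ, fun _ hT => hI.branches_inter_nonempty hT⟩
    tfae_have 3 → 1
    | ⟨δ, hδ, hmeets⟩ =>
      ⟨_, hδ.div_const four_pos, (hdich hδ).resolve_right fun ⟨T, hT, hTB⟩ =>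
        let ⟨_, hx, hxB⟩ := hmeets T hT
        (hTB hx).2 hxB⟩
    tfae_finish
  · refine ⟨fun hI δ hδ => ?_, fun hII ⟨δ, hδ, hI⟩ => hI.not_strategyII_sdiff (hII δ hδ)⟩
    rcases hdich hδ with ⟨m, hm, h⟩ | ⟨T, hT, hTB⟩
    · exact absurd ⟨_, hδ.div_const four_pos, strategyI_of_relR hm h⟩ hI
    · exact hT.strategyII_branches.mono hTB
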